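/- Let $N\ge 1$. For an elliptic curve $E:\ y^2=x^3+Ax+B$ over a field in which $6N$ is invertible, with a naive level structure $\beta:(\mathbb Z/N\mathbb Z)^2\simeq E[N]$, and a nonzero $v\in(\mathbb Z/N\mathbb Z)^2$, Makdisi's weight-1 Eisenstein series $f_1^v$ takes the value $$f_1^v(E,\beta)=\frac1N\sum_{x\in\mathbb Z/N\mathbb Z}\lambda_{\beta(v),\,\beta(w+xv)},$$ where $w\in(\mathbb Z/N\mathbb Z)^2$ is any vector that is not a multiple of $v$, and $\lambda_{R,S}$ is the slope of the line joining $R$ and $S$. For $\tau$ in the upper half-plane let $E_\tau:\ y^2=x^3-\frac{g_2}{4}x-\frac{g_3}{4}$ be the equation of $\mathbb C/(\mathbb Z\tau\oplus\mathbb Z)$ under $u\mapsto(\wp(u),\wp'(u)/2)$ (so $dx/2y=du$), let $q_N=e^{2\pi i\tau/N}$, and normalise the Weil pairing by $e_N(\tau/N,1/N)=e^{2\pi i/N}$. For a primitive $N$-th root of unity $z=e^{2\pi ik/N}$, let $\beta_\tau$ be the level structure on $E_\tau$ sending the standard basis $(1,0),(0,1)$ to the points $P,Q$ that are the images of $\tau/N$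 and $k/N$; thus $e_N(P,Q)=z$. The $q_N$-expansion of $f_1^v$ is the expansion of $\tau\mapsto f_1^v(E_\tau,\beta_\tau)$. **Theorem.** There is a nonzero constant $C\in\mathbb C$ depending only on $N$ such that for every primitive $N$-th root of unity $z\in\mathbb{C}$, all integers $c,d$ with $0\le c<N$ such that $v=(c,d)$ is nonzero in $(\mathbb Z/N\mathbb Z)^2$, and all $\tau$ in the upper half-plane, $$f_1^v(E_\tau,\beta_\tau)=C\sum_{n=0}^{\infty}a_n q_N^n\qquad\text{(a convergent series)},$$ where $$a_0=\begin{cases}\dfrac12\,\dfrac{1+z^d}{1-z^d}& \text{if } c=0,\\[2mm] \dfrac12-\dfrac cN&\text{if } c\ne0,\end{cases} \qquad a_n=\sum_{\substack{a,b\in\mathbb Z\\ ab=n\\ a\equiv c \bmod N}}\operatorname{sgn}(b)\,z^{bd}\quad(n\ge1).$$ In particular the value of $f_1^v(E_\tau,\beta_\tau)$ does not depend on the choice of $w$. -/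

import Mathlib

noncomputable section

namespace Makdisi

open WeierstrassCurve

/-- A naive level `N` structure on the elliptic curve `W` over the field `F`: a group isomorphism
`β : (ℤ/Nℤ)² ≃ E[N]`. -/
abbrev LevelStructure {F : Type*} [Field F] [DecidableEq F] (N : ℕ) (W : WeierstrassCurve F) :
    Type _ :=
  (ZMod N × ZMod N) ≃+ AddSubgroup.torsionBy W.toAffine.Point (N : ℤ)

/-- The slope of the line joining two affine points of `W` (tangent line if they coincide), in the
coordinates of the given Weierstrass equation. The value is `0` (and irrelevant) if one of the
points is the point at infinity or if the line is vertical. -/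
def lineSlope {F : Type*} [Field F] [DecidableEq F] {W : WeierstrassCurve F} :
    W.toAffine.Point → W.toAffine.Point → F
  | .some x₁ y₁ _, .some x₂ y₂ _ => W.toAffine.slope x₁ x₂ y₁ y₂
  | _, _ => 0

/-- The value `f₁^v(W, β)` of the weight-one Eisenstein series of Makdisi (for a short Weierstrass
equation over a field in which `6N` is invertible), read off the slopes of the
lines joining `N`-torsion points:
`f₁^v = (1/N) ∑_{x mod N} λ(β(v), β(w + x v))`, where `w` is any auxiliary vector that is not a
multiple of `v` (all the lines are then non-vertical secants).

The forms `f₁^v` are the odd (`f₁^{-v} = -f₁^v`) functions of `v` with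
`f₁^{v₁} + f₁^{v₂} + f₁^{v₃} = ` slope of the line through `β(v₁), β(v₂), β(v₃)` whenever
`v₁ + v₂ + v₃ = 0` and all `vᵢ ≠ 0`; summing this over `v₁ = v`, `v₂ = w + x v`, the terms
`f₁^{w + x v} - f₁^{w + (x + 1) v}` telescope around the cycle and `N f₁^v` is left. -/
def f₁ {F : Type*} [Field F] [DecidableEq F] {N : ℕ} [NeZero N] {W : WeierstrassCurve F}
    (β : LevelStructure N W) (v w : ZMod N × ZMod N) : F :=
  (1 / (N : F)) * ∑ x : ZMod N,
    lineSlope (β v : W.toAffine.Point) (β (w + x • v) : W.toAffine.Point)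

/-- The ordered basis `(τ, 1)` of periods attached to a point `τ` of the upper half-plane. -/
def periods (τ : UpperHalfPlane) : PeriodPair where
  ω₁ := (τ : ℂ)
  ω₂ := 1
  indep := by
    rw [LinearIndependent.pair_iff]
    intro s t h
    have him := congrArg Complex.im h
    have hs : s = 0 := by
      have : s * τ.im = 0 := by simpa using him
      exact (mul_eq_zero.mp this).resolve_right τ.im_pos.ne'
    subst hs
    have hre := congrArg Complex.re h
    exact ⟨rfl, by simpa using hre⟩

/-- The short Weierstrass equation `y² = x³ - (g₂/4) x - g₃/4` of `ℂ/(ℤτ ⊕ ℤ)`. It is satisfied by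
`x = ℘(u)`, `y = ℘'(u)/2`, and its differential `dx/2y` is `du`. -/
def curve (τ : UpperHalfPlane) : WeierstrassCurve ℂ where
  a₁ := 0
  a₂ := 0
  a₃ := 0
  a₄ := -(periods τ).g₂ / 4
  a₆ := -(periods τ).g₃ / 4

/-- `Uniformizes τ u P`: the point `P` of the curve attached to `τ` is the image of the class of `u`
under the Weierstrass uniformisation `ℂ/(ℤτ ⊕ ℤ) ≃ E`, `u ↦ (℘(u), ℘'(u)/2)`, `0 ↦ ∞`. -/
def Uniformizes (τ : UpperHalfPlane) (u : ℂ) (P : (curve τ).toAffine.Point) : Prop :=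
  (u ∈ (periods τ).lattice ∧ P = 0) ∨
  (u ∉ (periods τ).lattice ∧
    ∃ h, P = .some ((periods τ).weierstrassP u) ((periods τ).derivWeierstrassP u / 2) h)

/-- The Weil pairing of the `N`-torsion points of `ℂ/(ℤω₁ ⊕ ℤω₂)` represented by `u` and `v`, where
`ω₁ = τ`, `ω₂ = 1`, normalised by `e_N(ω₁/N, ω₂/N) = exp(2πi/N)`. Explicitly
`e_N((aω₁ + bω₂)/N, (cω₁ + dω₂)/N) = exp(2πi(ad - bc)/N)`, and
`ad - bc = N² Im(u v̄) / Im(ω₁ ω̄₂)`. -/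
def weilPairing (N : ℕ) (τ : UpperHalfPlane) (u v : ℂ) : ℂ :=
  Complex.exp (2 * Real.pi * Complex.I *
    ((N * ((u * (starRingEnd ℂ) v).im / τ.im) : ℝ) : ℂ))

/-- The `n`-th coefficient `a_n`, for the vector `(c, d)` with `0 ≤ c < N` and the root of
unity `z`. For `n ≥ 1` the sum is over all pairs of integers `(a, b)` with `ab = n` and
`a ≡ c mod N` (both then lie between `-n` and `n`). -/
def coeff (N : ℕ) (z : ℂ) (c : ℕ) (d : ℤ) (n : ℕ) : ℂ :=
  if n = 0 then
    if c = 0 then (1 / 2) * ((1 + z ^ d) / (1 - z ^ d)) else 1 / 2 - (c : ℂ) / (N : ℂ)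
  else
    ∑ p ∈ (Finset.Icc (-(n : ℤ)) n ×ˢ Finset.Icc (-(n : ℤ)) n).filter
        (fun p => p.1 * p.2 = (n : ℤ) ∧ p.1 ≡ (c : ℤ) [ZMOD (N : ℤ)]),
      ((Int.sign p.2 : ℤ) : ℂ) * z ^ (p.2 * d)

/-- `q_N = exp(2πiτ/N)`. -/
def qN (N : ℕ) (τ : UpperHalfPlane) : ℂ :=
  Complex.exp (2 * Real.pi * Complex.I * (τ : ℂ) / (N : ℂ))

end Makdisi

end

noncomputable section

namespace Makdisi

open Complex Filter Topology

/-! With t = exp(2πiu) and q = exp(2πiτ), the Lambert series F = `quasiZeta` satisfies F(u + 1) =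
F(u) and F(u + τ) = F(u) + 1, and 2πiF has principal part -1/u at 0. Classically 2πiF is -ζ plus a
linear term, which cancels in S(u, v) = 2πi(F(u) + F(v) - F(u + v)), so S is the slope of the chord
through the points with parameters u and v. The slope formula `two_mul_chordSlope_mul` rests on
Liouville's theorem: S² - ℘(u) - ℘(u + v) is elliptic in u without poles, hence constant, and
differentiating it relates S to ℘ and ℘'. The same formula shows that ℘ is injective up to sign and
that u ↦ (℘(u), ℘'(u)/2) respects addition (`Uniformizes.add`), so β(w + xv) has an explicit
parameter V + xU, where U is that of β(v). Summed over x, the slopes telescope to 2πi(N F(U) - (F(V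
+ NU) - F(V))). As NU is cτ plus an integer, the inner difference is c, whence `f₁_eq_quasiZeta`:
the value is 2πi(F(U) - c/N), free of w. Expanding F geometrically and grouping by n = ab gives the
coefficients (`hasSum_coeff`), with C = 2πi. -/

section LambertSeries

/-! ### The function `F` with `F (u + 1) = F u`, `F (u + τ) = F u + 1` and simple poles on the
lattice, given by its Lambert series -/

/-- The function `t / (1 - t)`, extended to `t = 1` by the value `-1 / 2`, so that
`geomKernel t + geomKernel t⁻¹ = -1` for all `t ≠ 0`. -/
def geomKernel (t : ℂ) : ℂ := (1 / 2) * ((1 + t) / (1 - t)) - 1 / 2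

lemma geomKernel_eq {t : ℂ} (ht : t ≠ 1) : geomKernel t = t / (1 - t) := by
  have : 1 - t ≠ 0 := sub_ne_zero.mpr ht.symm
  unfold geomKernel
  field_simp
  ring

lemma geomKernel_add_inv {t : ℂ} (ht : t ≠ 0) : geomKernel t + geomKernel t⁻¹ = -1 := by
  rcases eq_or_ne t 1 with rfl | h1
  · norm_num [geomKernel]
  · have h2 : t⁻¹ ≠ 1 := by simpa using h1
    rw [geomKernel_eq h1, geomKernel_eq h2]
    have h3 : 1 - t ≠ 0 := sub_ne_zero.mpr h1.symm
    have h4 : t - 1 ≠ 0 := sub_ne_zero.mpr h1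
    have h5 : 1 - t⁻¹ ≠ 0 := sub_ne_zero.mpr h2.symm
    field_simp
    ring

lemma norm_geomKernel_le {t : ℂ} {ρ : ℝ} (hρ : ρ < 1) (ht : ‖t‖ ≤ ρ) :
    ‖geomKernel t‖ ≤ ‖t‖ / (1 - ρ) := by
  have h1 : t ≠ 1 := by
    rintro rfl
    rw [norm_one] at ht
    linarith
  rw [geomKernel_eq h1, norm_div]
  have : 1 - ρ ≤ ‖1 - t‖ := by
    have := norm_sub_norm_le (1 : ℂ) t
    rw [norm_one] at this
    linarith
  gcongr

/-- The Lambert series `∑_{n ≥ 1} qⁿt / (1 - qⁿt)`. -/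
def lambertSum (q t : ℂ) : ℂ := ∑' n : ℕ, geomKernel (q ^ (n + 1) * t)

/-- Since t is arbitrary, early terms can be large or sit at the pole; the geometric majorant holds
only once the argument has norm below 1/2. -/
lemma summable_lambertSum {q : ℂ} (hq : ‖q‖ < 1) (t : ℂ) :
    Summable fun n : ℕ => geomKernel (q ^ (n + 1) * t) := by
  have h0 : Tendsto (fun n : ℕ => ‖q ^ (n + 1) * t‖) atTop (𝓝 0) := by
    have := (((tendsto_pow_atTop_nhds_zero_of_norm_lt_one hq).comp (tendsto_add_atTop_nat 1)).mul_const
      t).norm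
    simpa using this
  have hs : Summable fun n : ℕ => ‖q ^ (n + 1) * t‖ / (1 - 1 / 2) := by
    have := ((summable_geometric_of_lt_one (norm_nonneg q) hq).mul_right (‖q‖ * ‖t‖)).div_const
      (1 - 1 / 2)
    refine this.congr fun n => ?_
    rw [norm_mul, norm_pow, pow_succ, mul_assoc]
  refine Summable.of_norm_bounded_eventually_nat hs ?_
  filter_upwards [h0.eventually (gt_mem_nhds (show (0 : ℝ) < 1 / 2 by norm_num))] with n hn
  exact norm_geomKernel_le (by norm_num) hn.le

lemma lambertSum_mul {q : ℂ} (hq : ‖q‖ < 1) (t : ℂ) :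
    lambertSum q (q * t) = lambertSum q t - geomKernel (q * t) := by
  have := (summable_lambertSum hq t).tsum_eq_zero_add
  simp only [lambertSum]
  rw [this]
  simp only [zero_add, pow_one, add_sub_cancel_left]
  refine tsum_congr fun n => ?_
  congr 1
  ring

/-- On ‖qw‖ < ρ < 1 every argument q^(n+1)w stays within radius ρ, away from the pole at 1, and a
geometric series dominates uniformly. -/
lemma analyticAt_lambertSum {q t : ℂ} (hq : ‖q‖ < 1) (ht : ‖q * t‖ < 1) :
    AnalyticAt ℂ (lambertSum q) t := by
  obtain ⟨ρ, h1, h2⟩ := exists_between ht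
  have hU : IsOpen {w : ℂ | ‖q * w‖ < ρ} := isOpen_lt (by fun_prop) (by fun_prop)
  have hρ0 : 0 ≤ ρ := (norm_nonneg _).trans h1.le
  have key : ∀ (n : ℕ) (w : ℂ), ‖q * w‖ < ρ → ‖q ^ (n + 1) * w‖ ≤ ‖q‖ ^ n * ρ := by
    intro n w hw
    rw [pow_succ, mul_assoc, norm_mul, norm_pow]
    gcongr
  have key' : ∀ n : ℕ, ‖q‖ ^ n * ρ ≤ ρ := fun n =>
    mul_le_of_le_one_left hρ0 (pow_le_one₀ (norm_nonneg _) hq.le)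
  have hd : DifferentiableOn ℂ (lambertSum q) {w : ℂ | ‖q * w‖ < ρ} := by
    refine differentiableOn_tsum_of_summable_norm (u := fun n : ℕ => ‖q‖ ^ n * ρ / (1 - ρ))
      (((summable_geometric_of_lt_one (norm_nonneg q) hq).mul_right ρ).div_const _) ?_ hU ?_
    · intro n w hw
      have hne : 1 - q ^ (n + 1) * w ≠ 0 := by
        intro h
        have h3 : q ^ (n + 1) * w = 1 := (sub_eq_zero.mp h).symm
        have h4 := (key n w hw).trans (key' n)
        rw [h3, norm_one] at h4
        linarith
      refine DifferentiableAt.differentiableWithinAt ?_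
      unfold geomKernel
      fun_prop (disch := exact hne)
    · intro n w hw
      refine (norm_geomKernel_le h2 ((key n w hw).trans (key' n))).trans ?_
      have : 0 < 1 - ρ := by linarith
      gcongr
      exact key n w hw
  exact hd.analyticAt (hU.mem_nhds h1)

/-! ### The quasi-periodic function attached to τ -/

/-- The function `u ↦ exp (2πiu)`. -/
def expPeriod (u : ℂ) : ℂ := exp (2 * Real.pi * I * u)

lemma expPeriod_add (u v : ℂ) : expPeriod (u + v) = expPeriod u * expPeriod v := by
  simp only [expPeriod, mul_add, exp_add]

lemma expPeriod_neg (u : ℂ) : expPeriod (-u) = (expPeriod u)⁻¹ := by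
  simp only [expPeriod, mul_neg, exp_neg]

lemma expPeriod_ne_zero (u : ℂ) : expPeriod u ≠ 0 := exp_ne_zero _

lemma expPeriod_one : expPeriod 1 = 1 := by
  simp [expPeriod]

lemma expPeriod_eq_one_iff {u : ℂ} : expPeriod u = 1 ↔ ∃ n : ℤ, u = n := by
  have := two_pi_I_ne_zero
  rw [expPeriod, exp_eq_one_iff]
  refine exists_congr fun n => ⟨fun h => ?_, fun h => ?_⟩
  · rw [mul_comm (n : ℂ)] at h
    exact mul_left_cancel₀ this h
  · rw [h, mul_comm]

lemma norm_expPeriod (u : ℂ) : ‖expPeriod u‖ = Real.exp (-(2 * Real.pi * u.im)) := by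
  rw [expPeriod, norm_exp]
  congr 1
  simp [mul_assoc]

lemma differentiable_expPeriod : Differentiable ℂ expPeriod := by
  unfold expPeriod
  fun_prop

lemma analyticAt_expPeriod (u : ℂ) : AnalyticAt ℂ expPeriod u := differentiable_expPeriod.analyticAt u

lemma norm_expPeriod_lt_one (τ : UpperHalfPlane) : ‖expPeriod τ‖ < 1 := by
  rw [norm_expPeriod, Real.exp_lt_one_iff]
  have := mul_pos Real.pi_pos τ.im_pos
  have : (τ : ℂ).im = τ.im := rfl
  rw [this]
  linarith

/-- The odd function `F` with simple poles at the points of `ℤτ + ℤ`, with `F (u + 1) = F u` and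
`F (u + τ) = F u + 1`. -/
def quasiZeta (τ : UpperHalfPlane) (u : ℂ) : ℂ :=
  1 / 2 + geomKernel (expPeriod u) + lambertSum (expPeriod τ) (expPeriod u)
    - lambertSum (expPeriod τ) (expPeriod u)⁻¹

variable (τ : UpperHalfPlane)

lemma quasiZeta_add_one (u : ℂ) : quasiZeta τ (u + 1) = quasiZeta τ u := by
  simp only [quasiZeta, expPeriod_add, expPeriod_one, mul_one]

lemma quasiZeta_neg (u : ℂ) : quasiZeta τ (-u) = -quasiZeta τ u := by
  simp only [quasiZeta, expPeriod_neg, inv_inv]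
  linear_combination geomKernel_add_inv (expPeriod_ne_zero u)

/-- Replacing t by qt shifts both series by one index. The net change is minus the kernel at t and
at t⁻¹, that is, 1. The value of `geomKernel` at 1 makes this hold at lattice points too. -/
lemma quasiZeta_add_tau (u : ℂ) : quasiZeta τ (u + τ) = quasiZeta τ u + 1 := by
  have hq := norm_expPeriod_lt_one τ
  have h1 := lambertSum_mul hq (expPeriod u)
  have h2 := lambertSum_mul hq (expPeriod τ * expPeriod u)⁻¹
  have h3 : expPeriod τ * (expPeriod τ * expPeriod u)⁻¹ = (expPeriod u)⁻¹ := by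
    have := expPeriod_ne_zero τ
    have := expPeriod_ne_zero u
    field_simp
  rw [h3] at h2
  simp only [quasiZeta, expPeriod_add, mul_comm (expPeriod u)]
  linear_combination h1 + h2 - geomKernel_add_inv (expPeriod_ne_zero u)

lemma quasiZeta_add_int (u : ℂ) (n : ℤ) : quasiZeta τ (u + n) = quasiZeta τ u := by
  induction n with
  | zero => simp
  | succ n ih => rw [← ih, ← quasiZeta_add_one τ (u + (n : ℤ))]; push_cast; rw [add_assoc]
  | pred n ih => rw [← ih, ← quasiZeta_add_one τ (u + _)]; push_cast; ring_nf

lemma quasiZeta_add_int_mul_tau (u : ℂ) (n : ℤ) :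
    quasiZeta τ (u + n * τ) = quasiZeta τ u + n := by
  induction n with
  | zero => simp
  | succ n ih =>
    have := quasiZeta_add_tau τ (u + (n : ℤ) * τ)
    rw [ih] at this
    push_cast at this ⊢
    rw [← add_assoc, ← this]
    ring_nf
  | pred n ih =>
    have := quasiZeta_add_tau τ (u + (-(n : ℤ) - 1 : ℤ) * τ)
    rw [show u + (-(n : ℤ) - 1 : ℤ) * (τ : ℂ) + τ = u + (-(n : ℤ) : ℤ) * τ by push_cast; ring,
      ih] at this
    push_cast at this ⊢
    linear_combination -this

lemma mem_lattice_periods {u : ℂ} :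
    u ∈ (periods τ).lattice ↔ ∃ m n : ℤ, m * (τ : ℂ) + n = u := by
  simp [PeriodPair.mem_lattice, periods]

lemma exists_quasiZeta_add_lattice (l : (periods τ).lattice) :
    ∃ m : ℂ, ∀ u, quasiZeta τ (u + l) = quasiZeta τ u + m := by
  obtain ⟨m, n, h⟩ := (mem_lattice_periods τ).mp l.2
  refine ⟨m, fun u => ?_⟩
  rw [← h, ← add_assoc, quasiZeta_add_int, quasiZeta_add_int_mul_tau]

/-- In this strip both qt and qt⁻¹ have norm below 1, so the poles of F there come from `geomKernel`
alone. -/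
lemma analyticAt_lambertSum_sub {u : ℂ} (hu : |u.im| < τ.im) :
    AnalyticAt ℂ (fun u => lambertSum (expPeriod τ) (expPeriod u)
      - lambertSum (expPeriod τ) (expPeriod u)⁻¹) u := by
  have hq := norm_expPeriod_lt_one τ
  have key : ∀ w : ℂ, |w.im| < τ.im → ‖expPeriod τ * expPeriod w‖ < 1 := by
    intro w hw
    rw [← expPeriod_add, norm_expPeriod, Real.exp_lt_one_iff]
    have h1 : (τ + w : ℂ).im = τ.im + w.im := rfl
    have := Real.pi_pos
    have h2 : 0 < (τ + w : ℂ).im := by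
      rw [h1]
      have := (abs_lt.mp hw).1
      linarith
    have := mul_pos Real.pi_pos h2
    linarith
  refine AnalyticAt.sub ?_ ?_
  · exact (analyticAt_lambertSum hq (key u hu)).comp (analyticAt_expPeriod u)
  · refine (analyticAt_lambertSum hq ?_).comp
      (f := fun u => (expPeriod u)⁻¹) ((analyticAt_expPeriod u).inv (expPeriod_ne_zero u))
    rw [← expPeriod_neg]
    exact key _ (by simpa using hu)

lemma analyticAt_quasiZeta {u : ℂ} (hu : u ∉ (periods τ).lattice) :
    AnalyticAt ℂ (quasiZeta τ) u := by
  have strip : ∀ w : ℂ, |w.im| < τ.im → w ∉ (periods τ).lattice → AnalyticAt ℂ (quasiZeta τ) w := by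
    intro w hw hwl
    have h1 : 1 - expPeriod w ≠ 0 := by
      intro h
      obtain ⟨n, hn⟩ := expPeriod_eq_one_iff.mp (sub_eq_zero.mp h).symm
      exact hwl ((mem_lattice_periods τ).mpr ⟨0, n, by simp [hn]⟩)
    have h2 : AnalyticAt ℂ (fun u => 1 / 2 + geomKernel (expPeriod u)) w := by
      unfold geomKernel
      have := analyticAt_expPeriod w
      fun_prop (disch := exact h1)
    exact (h2.add (analyticAt_lambertSum_sub τ hw)).congr
      (Eventually.of_forall fun u => by simp only [quasiZeta, Pi.add_apply]; ring)
  -- Translation by nτ brings u into the strip 0 ≤ Im < Im τ and changes F only by a constant.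
  set n : ℤ := -⌊u.im / τ.im⌋ with hn
  have him : (u + n * τ : ℂ).im = u.im + n * τ.im := by
    simp
  have hτ := τ.im_pos
  have h1 : |(u + n * τ : ℂ).im| < τ.im := by
    rw [him, hn]
    have h2 := Int.floor_le (u.im / τ.im)
    have h3 := Int.lt_floor_add_one (u.im / τ.im)
    rw [le_div_iff₀ hτ] at h2
    rw [div_lt_iff₀ hτ] at h3
    push_cast
    rw [abs_lt]
    constructor <;> linarith
  have h2 : u + n * τ ∉ (periods τ).lattice := by
    intro h
    have h4 : (n * τ : ℂ) ∈ (periods τ).lattice := (mem_lattice_periods τ).mpr ⟨n, 0, by simp⟩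
    exact hu (by simpa using sub_mem h h4)
  have h3 : quasiZeta τ = fun w => quasiZeta τ (w + n * τ) - n := by
    funext w
    rw [quasiZeta_add_int_mul_tau, add_sub_cancel_right]
  rw [h3]
  refine AnalyticAt.sub ?_ analyticAt_const
  exact (strip _ h1 h2).comp (f := fun w : ℂ => w + n * τ) (by fun_prop)

/-! ### Local behaviour at the pole 0 -/

lemma exists_analyticAt_eq_add_mul {f : ℂ → ℂ} (hf : AnalyticAt ℂ f 0) :
    ∃ g : ℂ → ℂ, AnalyticAt ℂ g 0 ∧ g 0 = deriv f 0 ∧ ∀ u, f u = f 0 + u * g u := by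
  refine ⟨dslope f 0, ?_, dslope_same f 0, fun u => ?_⟩
  · obtain ⟨p, hp⟩ := hf
    exact hp.has_fpower_series_dslope_fslope.analyticAt
  · have := sub_smul_dslope f 0 u
    rw [sub_zero, smul_eq_mul] at this
    rw [this]
    ring

lemma eventually_notMem_lattice (L : PeriodPair) {x : ℂ} :
    ∀ᶠ u in 𝓝[≠] x, u ∉ L.lattice := by
  filter_upwards [self_mem_nhdsWithin, mem_nhdsWithin_of_mem_nhds
    (L.compl_lattice_sdiff_singleton_mem_nhds x)] with w hw hw'
  simp_all

lemma exists_quasiZeta_eq_add :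
    ∃ h : ℂ → ℂ, AnalyticAt ℂ h 0 ∧
      ∀ᶠ u in 𝓝[≠] (0 : ℂ), 2 * Real.pi * I * quasiZeta τ u = -1 / u + h u := by
  obtain ⟨g₁, hg₁, hg₁0, hg₁'⟩ := exists_analyticAt_eq_add_mul (analyticAt_expPeriod 0)
  obtain ⟨g₂, hg₂, -, hg₂'⟩ := exists_analyticAt_eq_add_mul hg₁
  have hd : g₁ 0 = 2 * Real.pi * I := by
    rw [hg₁0]
    have : HasDerivAt expPeriod (exp (2 * Real.pi * I * 0) * (2 * Real.pi * I * 1)) 0 :=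
      ((hasDerivAt_id (0 : ℂ)).const_mul _).cexp
    simpa using this.deriv
  have he0 : expPeriod 0 = 1 := by simp [expPeriod]
  have hne : g₁ 0 ≠ 0 := hd ▸ two_pi_I_ne_zero
  -- With t = 1 + u g₁ and g₁ = 2πi + u g₂, the singular part is -2πi/(u g₁) - πi = -1/u + g₂/g₁ -
  -- πi.
  refine ⟨fun u => (g₂ u - Real.pi * I * g₁ u) / g₁ u + 2 * Real.pi * I *
    (lambertSum (expPeriod τ) (expPeriod u) - lambertSum (expPeriod τ) (expPeriod u)⁻¹), ?_, ?_⟩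
  · have := analyticAt_lambertSum_sub τ (u := 0) (by simpa using τ.im_pos)
    fun_prop (disch := exact hne)
  · filter_upwards [self_mem_nhdsWithin,
      mem_nhdsWithin_of_mem_nhds (hg₁.continuousAt.eventually_ne hne)] with u hu hgu
    have hu : u ≠ 0 := hu
    have h1 := hg₁' u
    have h2 := hg₂' u
    rw [he0] at h1
    rw [hd] at h2
    have h3 : 1 / 2 + geomKernel (expPeriod u) = (1 / 2) * ((2 + u * g₁ u) / (-(u * g₁ u))) := by
      rw [h1, geomKernel]
      ring
    have h4 : 2 * Real.pi * I * (1 / 2 + geomKernel (expPeriod u))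
        = -1 / u + (g₂ u - Real.pi * I * g₁ u) / g₁ u := by
      rw [h3]
      field_simp
      linear_combination h2
    unfold quasiZeta
    linear_combination h4

lemma eventually_nhdsNE_zero_neg {p : ℂ → Prop} (h : ∀ᶠ u in 𝓝[≠] (0 : ℂ), p u) :
    ∀ᶠ u in 𝓝[≠] (0 : ℂ), p (-u) := by
  have : Tendsto (fun u : ℂ => -u) (𝓝[≠] 0) (𝓝[≠] 0) := by
    refine tendsto_nhdsWithin_iff.mpr ⟨?_, ?_⟩
    · have : Tendsto (fun u : ℂ => -u) (𝓝 0) (𝓝 (-0)) := (continuous_neg.tendsto 0)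
      rw [neg_zero] at this
      exact this.mono_left nhdsWithin_le_nhds
    · filter_upwards [self_mem_nhdsWithin] with u hu
      simpa using hu
  exact this.eventually h

/-- Oddness of F kills the constant term. Without this, squaring the chord function would leave a
simple pole. -/
lemma exists_quasiZeta_eq_add_mul :
    ∃ k : ℂ → ℂ, AnalyticAt ℂ k 0 ∧
      ∀ᶠ u in 𝓝[≠] (0 : ℂ), 2 * Real.pi * I * quasiZeta τ u = -1 / u + u * k u := by
  obtain ⟨h, hh, hF⟩ := exists_quasiZeta_eq_add τ
  have h0 : h 0 = 0 := by
    have h1 : ∀ᶠ u in 𝓝[≠] (0 : ℂ), h (-u) = -h u := by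
      filter_upwards [hF, eventually_nhdsNE_zero_neg hF] with u h1 h2
      rw [quasiZeta_neg] at h2
      linear_combination -h1 - h2
    have t1 : Tendsto h (𝓝[≠] 0) (𝓝 (h 0)) := hh.continuousAt.tendsto.mono_left nhdsWithin_le_nhds
    have t2 : Tendsto (fun u => h (-u)) (𝓝[≠] 0) (𝓝 (h 0)) := by
      have : ContinuousAt (fun u => h (-u)) 0 :=
        ContinuousAt.comp (by simpa using hh.continuousAt) continuous_neg.continuousAt
      simpa using this.tendsto.mono_left nhdsWithin_le_nhds
    have := tendsto_nhds_unique t2 (t1.neg.congr' (h1.mono fun u hu => hu.symm))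
    linear_combination this / 2
  obtain ⟨k, hk, -, hk'⟩ := exists_analyticAt_eq_add_mul hh
  refine ⟨k, hk, hF.mono fun u hu => ?_⟩
  rw [hu, hk' u, h0, zero_add]

end LambertSeries

section ChordSlope

/-! ### Elliptic functions with removable singularities are constant -/

/-- `f` agrees with an analytic function on a punctured neighbourhood of `x`. -/
def Removable (f : ℂ → ℂ) (x : ℂ) : Prop :=
  ∃ g : ℂ → ℂ, AnalyticAt ℂ g x ∧ f =ᶠ[𝓝[≠] x] g

lemma tendsto_nhdsNE_of_injective {m : ℂ → ℂ} {y : ℂ} (hm : ContinuousAt m y)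
    (hinj : Function.Injective m) : Tendsto m (𝓝[≠] y) (𝓝[≠] (m y)) := by
  refine tendsto_nhdsWithin_iff.mpr ⟨hm.tendsto.mono_left nhdsWithin_le_nhds, ?_⟩
  filter_upwards [self_mem_nhdsWithin] with u hu
  exact fun h => hu (hinj h)

lemma Removable.comp {f m : ℂ → ℂ} {y : ℂ} (hf : Removable f (m y)) (hm : AnalyticAt ℂ m y)
    (hinj : Function.Injective m) : Removable (fun u => f (m u)) y := by
  obtain ⟨g, hg, hfg⟩ := hf
  exact ⟨fun u => g (m u), hg.comp hm, (tendsto_nhdsNE_of_injective hm.continuousAt hinj).eventually hfg⟩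

lemma Removable.of_analyticAt {f : ℂ → ℂ} {x : ℂ} (hf : AnalyticAt ℂ f x) : Removable f x :=
  ⟨f, hf, EventuallyEq.rfl⟩

lemma exists_eq_of_periodic_of_removable (L : PeriodPair) {f : ℂ → ℂ}
    (hper : ∀ (l : L.lattice) (u : ℂ), f (u + l) = f u) (hrem : ∀ x, Removable f x) :
    ∃ c, ∀ x, ContinuousAt f x → f x = c := by
  -- Punctured limits discard the arbitrary values of f at its removable singularities. The result
  -- is entire and periodic, hence bounded; f is recovered only where it is continuous.
  set F : ℂ → ℂ := fun x => limUnder (𝓝[≠] x) f with hF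
  have lim_eq : ∀ {x : ℂ} {g : ℂ → ℂ}, ContinuousAt g x → f =ᶠ[𝓝[≠] x] g → F x = g x :=
    fun hg hfg =>
      ((hg.tendsto.mono_left nhdsWithin_le_nhds).congr' hfg.symm).limUnder_eq
  have hFa : ∀ x, AnalyticAt ℂ F x := by
    intro x
    obtain ⟨g, hg, hfg⟩ := hrem x
    refine hg.congr ?_
    have h1 : ∀ᶠ y in 𝓝[≠] x, F y = g y := by
      filter_upwards [eventually_eventually_nhdsWithin.mpr hfg, self_mem_nhdsWithin,
        mem_nhdsWithin_of_mem_nhds hg.eventually_analyticAt] with y h2 h3 h4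
      refine lim_eq h4.continuousAt ?_
      rw [IsOpen.nhdsWithin_eq isOpen_compl_singleton h3] at h2
      exact EventuallyEq.filter_mono h2 nhdsWithin_le_nhds
    rw [eventually_nhdsWithin_iff] at h1
    filter_upwards [h1] with y hy
    by_cases hyx : y = x
    · rw [hyx, lim_eq hg.continuousAt hfg]
    · exact (hy hyx).symm
  have hFper : ∀ z w, w ∈ L.lattice → F (z + w) = F z := by
    intro z w hw
    obtain ⟨g, hg, hfg⟩ := hrem z
    rw [lim_eq hg.continuousAt hfg]
    have h1 : (z + w) - w = z := add_sub_cancel_right z w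
    have h2 : ContinuousAt (fun u => g (u - w)) (z + w) :=
      ContinuousAt.comp (by rw [h1]; exact hg.continuousAt) (by fun_prop)
    have h3 : f =ᶠ[𝓝[≠] (z + w)] fun u => g (u - w) := by
      have h4 := tendsto_nhdsNE_of_injective (m := fun u => u - w) (y := z + w) (by fun_prop)
        (sub_left_injective)
      rw [h1] at h4
      filter_upwards [h4.eventually hfg] with u hu
      rw [← hu, ← hper ⟨w, hw⟩ (u - w), sub_add_cancel]
    rw [lim_eq h2 h3, h1]
  have hd : Differentiable ℂ F := fun x => (hFa x).differentiableAt
  refine ⟨F 0, fun x hx => ?_⟩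
  rw [← lim_eq hx EventuallyEq.rfl]
  exact hd.apply_eq_apply_of_bounded
    (IsZLattice.isCompact_range_of_periodic L.lattice F hd.continuous hFper).isBounded x 0

lemma removable_of_mem_lattice (L : PeriodPair) {f : ℂ → ℂ}
    (hper : ∀ (l : L.lattice) (u : ℂ), f (u + l) = f u) (h0 : Removable f 0) {x : ℂ}
    (hx : x ∈ L.lattice) : Removable f x := by
  have h1 : Removable (fun u => f (u - x)) x :=
    Removable.comp (m := fun u => u - x) (by simpa using h0) (by fun_prop) sub_left_injective
  convert h1 using 2 with u
  rw [← hper ⟨x, hx⟩ (u - x), sub_add_cancel]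

lemma weierstrassP_eq_weierstrassPExcept_add (L : PeriodPair) (u : ℂ) :
    L.weierstrassP u = L.weierstrassPExcept 0 u + 1 / u ^ 2 := by
  simpa using (L.weierstrassPExcept_add 0 u).symm

lemma derivWeierstrassP_eq_derivWeierstrassPExcept_sub (L : PeriodPair) (u : ℂ) :
    L.derivWeierstrassP u = L.derivWeierstrassPExcept 0 u - 2 / u ^ 3 := by
  simpa using (L.derivWeierstrassPExcept_sub 0 u).symm

/-! ### The slope of a chord in terms of the quasi-periodic function `F` -/

variable (τ : UpperHalfPlane)

/-- Differentiation kills the additive quasi-periods, and both sides have polar part 1/u² at 0, so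
the difference is an elliptic function without poles. -/
lemma exists_deriv_quasiZeta_eq :
    ∃ e : ℂ, ∀ u ∉ (periods τ).lattice,
      2 * Real.pi * I * deriv (quasiZeta τ) u = (periods τ).weierstrassP u + e := by
  set L := periods τ
  set f : ℂ → ℂ := fun u => 2 * Real.pi * I * deriv (quasiZeta τ) u - L.weierstrassP u with hf
  have hper : ∀ (l : L.lattice) (u : ℂ), f (u + l) = f u := by
    intro l u
    obtain ⟨m, hm⟩ := exists_quasiZeta_add_lattice τ l
    have : deriv (quasiZeta τ) (u + l) = deriv (quasiZeta τ) u := by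
      rw [← deriv_comp_add_const, funext hm, deriv_add_const]
    simp only [hf, this, PeriodPair.weierstrassP_add_coe]
  have han : ∀ x ∉ L.lattice, AnalyticAt ℂ f x := by
    intro x hx
    have h1 := (analyticAt_quasiZeta τ hx).deriv
    have h2 := L.analyticOnNhd_weierstrassP x hx
    exact (analyticAt_const.mul h1).sub h2
  have h0 : Removable f 0 := by
    obtain ⟨h, hh, hF⟩ := exists_quasiZeta_eq_add τ
    refine ⟨fun u => deriv h u - L.weierstrassPExcept 0 u,
      hh.deriv.sub (L.analyticAt_weierstrassPExcept 0), ?_⟩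
    filter_upwards [eventually_eventually_nhdsWithin.mpr hF, self_mem_nhdsWithin,
      mem_nhdsWithin_of_mem_nhds hh.eventually_analyticAt] with u h1 h2 h3
    rw [IsOpen.nhdsWithin_eq isOpen_compl_singleton h2] at h1
    have hu : u ≠ 0 := h2
    have h4 := EventuallyEq.deriv_eq h1
    rw [deriv_const_mul_field] at h4
    have h5 : HasDerivAt (fun u => -1 / u + h u) (1 / u ^ 2 + deriv h u) u := by
      have := ((hasDerivAt_inv hu).neg).add h3.differentiableAt.hasDerivAt
      exact (this.congr_of_eventuallyEq (.of_forall fun w => by simp [neg_div])).congr_deriv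
        (by simp)
    simp only [hf, h4, h5.deriv, weierstrassP_eq_weierstrassPExcept_add]
    ring
  obtain ⟨e, he⟩ := exists_eq_of_periodic_of_removable L hper fun x => by
    by_cases hx : x ∈ L.lattice
    · exact removable_of_mem_lattice L hper h0 hx
    · exact .of_analyticAt (han x hx)
  refine ⟨e, fun u hu => ?_⟩
  rw [← he u (han u hu).continuousAt]
  simp [hf]

/-- The chord function `2πi (F u + F v - F (u + v))`; it is the slope of the line through the points
with parameters `u` and `v`. -/
def chordSlope (u v : ℂ) : ℂ :=
  2 * Real.pi * I * (quasiZeta τ u + quasiZeta τ v - quasiZeta τ (u + v))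

/-- The quasi-periods cancel in S, and near 0 one has S = -1/u + O(u), so subtracting ℘(u) removes
the whole pole of S². -/
lemma chordSlope_sq_sub_const {v : ℂ} (hv : v ∉ (periods τ).lattice) :
    ∃ e : ℂ, ∀ u ∉ (periods τ).lattice, u + v ∉ (periods τ).lattice →
      chordSlope τ u v ^ 2 - (periods τ).weierstrassP u - (periods τ).weierstrassP (u + v) = e := by
  set L := periods τ
  set f : ℂ → ℂ := fun u =>
    chordSlope τ u v ^ 2 - L.weierstrassP u - L.weierstrassP (u + v) with hf
  have hper : ∀ (l : L.lattice) (u : ℂ), f (u + l) = f u := by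
    intro l u
    obtain ⟨m, hm⟩ := exists_quasiZeta_add_lattice τ l
    simp only [hf, chordSlope, add_right_comm u _ v, PeriodPair.weierstrassP_add_coe, hm]
    ring
  -- This reflection exchanges the pole classes 0 and -v, so only the one at 0 needs a computation.
  have hrefl : ∀ u, f (-v - u) = f u := by
    intro u
    have h1 : -v - u = -(u + v) := by ring
    have h2 : -v - u + v = -u := by ring
    simp only [hf, chordSlope, h2]
    rw [h1]
    simp only [quasiZeta_neg, PeriodPair.weierstrassP_neg]
    ring
  have han : ∀ x ∉ L.lattice, x + v ∉ L.lattice → AnalyticAt ℂ f x := by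
    intro x hx hxv
    have h1 := analyticAt_quasiZeta τ hx
    have h2 : AnalyticAt ℂ (fun u => quasiZeta τ (u + v)) x :=
      AnalyticAt.comp (f := fun u => u + v) (analyticAt_quasiZeta τ hxv) (by fun_prop)
    have h3 := L.analyticOnNhd_weierstrassP x hx
    have h4 : AnalyticAt ℂ (fun u => L.weierstrassP (u + v)) x :=
      AnalyticAt.comp (f := fun u => u + v) (L.analyticOnNhd_weierstrassP _ hxv) (by fun_prop)
    simp only [hf, chordSlope]
    fun_prop
  have h0 : Removable f 0 := by
    obtain ⟨k, hk, hF⟩ := exists_quasiZeta_eq_add_mul τ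
    have hv' : (0 : ℂ) + v ∉ L.lattice := by rwa [zero_add]
    have h2 : AnalyticAt ℂ (fun u => quasiZeta τ (u + v)) 0 :=
      AnalyticAt.comp (f := fun u => u + v) (analyticAt_quasiZeta τ hv') (by fun_prop)
    have h4 : AnalyticAt ℂ (fun u => L.weierstrassP (u + v)) 0 :=
      AnalyticAt.comp (f := fun u => u + v) (L.analyticOnNhd_weierstrassP _ hv') (by fun_prop)
    obtain ⟨g, hg, -, hg'⟩ := exists_analyticAt_eq_add_mul h2
    have h5 := L.analyticAt_weierstrassPExcept 0
    refine ⟨fun u => -2 * (k u - 2 * Real.pi * I * g u) + (u * (k u - 2 * Real.pi * I * g u)) ^ 2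
      - L.weierstrassPExcept 0 u - L.weierstrassP (u + v), by fun_prop, ?_⟩
    filter_upwards [hF, self_mem_nhdsWithin] with u h1 hu
    have hu : u ≠ 0 := hu
    have h6 : chordSlope τ u v = -1 / u + u * (k u - 2 * Real.pi * I * g u) := by
      have := hg' u
      simp only [zero_add] at this
      simp only [chordSlope, this]
      linear_combination h1
    simp only [hf, h6, weierstrassP_eq_weierstrassPExcept_add L u]
    field_simp
    ring
  obtain ⟨e, he⟩ := exists_eq_of_periodic_of_removable L hper fun x => by
    by_cases hx : x ∈ L.lattice
    · exact removable_of_mem_lattice L hper h0 hx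
    · by_cases hxv : x + v ∈ L.lattice
      · have h1 : Removable f (-v - x) := by
          refine removable_of_mem_lattice L hper h0 ?_
          rw [show -v - x = -(x + v) by ring]
          exact neg_mem hxv
        have h2 := h1.comp (m := fun u => -v - u) (by fun_prop) sub_right_injective
        simpa only [hrefl] using h2
      · exact .of_analyticAt (han x hx hxv)
  exact ⟨e, fun u hu huv => he u (han u hu huv).continuousAt⟩

lemma eventually_notMem_lattice_nhds (L : PeriodPair) {x : ℂ} (hx : x ∉ L.lattice) :
    ∀ᶠ u in 𝓝 x, u ∉ L.lattice :=
  L.isClosed_lattice.isOpen_compl.mem_nhds hx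

lemma hasDerivAt_weierstrassP (L : PeriodPair) {x : ℂ} (hx : x ∉ L.lattice) :
    HasDerivAt L.weierstrassP (L.derivWeierstrassP x) x := by
  rw [← L.deriv_weierstrassP]
  exact (L.analyticOnNhd_weierstrassP x hx).differentiableAt.hasDerivAt

/-- The chord function is the slope of the secant. -/
lemma two_mul_chordSlope_mul {u v : ℂ} (hu : u ∉ (periods τ).lattice)
    (hv : v ∉ (periods τ).lattice) (huv : u + v ∉ (periods τ).lattice) :
    2 * (chordSlope τ u v * ((periods τ).weierstrassP u - (periods τ).weierstrassP v)) =
      (periods τ).derivWeierstrassP u - (periods τ).derivWeierstrassP v := by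
  set L := periods τ
  -- Differentiate S(x, w)² - ℘(x) - ℘(x + w) at x = u with w held fixed. There x + w = -v, so S(u,
  -- w) = S(u, v), and S' = ℘(u) - ℘(v) because the constant e' cancels.
  set w := -(u + v) with hw
  have hwL : w ∉ L.lattice := fun h => huv (by simpa [hw] using neg_mem h)
  have huw : u + w = -v := by rw [hw]; ring
  have huwL : u + w ∉ L.lattice := by
    rw [huw]
    exact fun h => hv (by simpa using neg_mem h)
  obtain ⟨e, he⟩ := chordSlope_sq_sub_const τ hwL
  obtain ⟨e', he'⟩ := exists_deriv_quasiZeta_eq τ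
  have hev : (fun x => chordSlope τ x w ^ 2 - L.weierstrassP x - L.weierstrassP (x + w))
      =ᶠ[𝓝 u] fun _ => e := by
    have h1 : Tendsto (fun x => x + w) (𝓝 u) (𝓝 (u + w)) := by
      have : ContinuousAt (fun x => x + w) u := by fun_prop
      exact this
    filter_upwards [eventually_notMem_lattice_nhds L hu,
      h1.eventually (eventually_notMem_lattice_nhds L huwL)] with x hx hxw
    exact he x hx hxw
  have d1 : HasDerivAt (quasiZeta τ) (deriv (quasiZeta τ) u) u :=
    (analyticAt_quasiZeta τ hu).differentiableAt.hasDerivAt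
  have d2 : HasDerivAt (fun x => quasiZeta τ (x + w)) (deriv (quasiZeta τ) (u + w)) u :=
    (analyticAt_quasiZeta τ huwL).differentiableAt.hasDerivAt.comp_add_const u w
  have d3 := hasDerivAt_weierstrassP L hu
  have d4 := (hasDerivAt_weierstrassP L huwL).comp_add_const u w
  have d5 := ((((d1.add_const (quasiZeta τ w)).sub d2).const_mul (2 * Real.pi * I)).pow 2).sub d3 |>.sub d4
  have h1 := hev.deriv_eq
  rw [deriv_const] at h1
  have h2 := d5.deriv.symm.trans h1
  have h3 := he' u hu
  have h4 := he' _ huwL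
  have hS : chordSlope τ u v =
      2 * Real.pi * I * (quasiZeta τ u + quasiZeta τ w - quasiZeta τ (u + w)) := by
    rw [huw, hw, chordSlope, quasiZeta_neg, quasiZeta_neg]
    ring
  simp only [Pi.sub_apply, ← hS] at h2
  rw [huw] at h2 h4
  simp only [PeriodPair.weierstrassP_neg, PeriodPair.derivWeierstrassP_neg] at h2 h4
  push_cast at h2
  linear_combination h2 - 2 * chordSlope τ u v * (h3 - h4)

end ChordSlope

section Uniformization

/-! ### Injectivity of `℘` up to sign -/

lemma notMem_of_eq {S : Submodule ℤ ℂ} {a b : ℂ} (h : a ∉ S) (e : b = a) : b ∉ S := e ▸ h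

lemma eventually_weierstrassP_ne (L : PeriodPair) {a : ℂ} (ha : a ∉ L.lattice) (c : ℂ) :
    ∀ᶠ w in 𝓝[≠] a, L.weierstrassP w ≠ c := by
  refine ((L.analyticOnNhd_weierstrassP a ha).eventually_eq_or_eventually_ne
    (analyticAt_const (v := c))).resolve_left fun h => ?_
  -- The complement of a countable set is connected, so a locally constant ℘ would be constant off
  -- the lattice, contradicting u²℘(u) → 1 at 0.
  have hc : (L.lattice : Set ℂ).Countable := by
    have : Countable L.lattice := L.latticeEquivProd.injective.countable
    exact Set.to_countable _
  have hconn : IsPreconnected ((L.lattice : Set ℂ)ᶜ) :=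
    (hc.isConnected_compl_of_one_lt_rank (by rw [Complex.rank_real_complex]; norm_num)).isPreconnected
  have heq := L.analyticOnNhd_weierstrassP.eqOn_of_preconnected_of_eventuallyEq
    analyticOnNhd_const hconn ha h
  have h1 : ∀ᶠ u in 𝓝[≠] (0 : ℂ), u ^ 2 * (c - L.weierstrassPExcept 0 u) = 1 := by
    filter_upwards [eventually_notMem_lattice L, self_mem_nhdsWithin] with u hu hu0
    have hu0 : u ≠ 0 := hu0
    have h2 : L.weierstrassP u = c := heq hu
    rw [← h2, weierstrassP_eq_weierstrassPExcept_add]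
    field_simp
    ring
  have h2 : Tendsto (fun u => u ^ 2 * (c - L.weierstrassPExcept 0 u)) (𝓝[≠] 0)
      (𝓝 (0 ^ 2 * (c - L.weierstrassPExcept 0 0))) := by
    have h3 := L.analyticAt_weierstrassPExcept 0
    have h4 : AnalyticAt ℂ (fun u => u ^ 2 * (c - L.weierstrassPExcept 0 u)) 0 := by fun_prop
    exact h4.continuousAt.tendsto.mono_left nhdsWithin_le_nhds
  have h3 := tendsto_nhds_unique h2 (tendsto_const_nhds.congr' (h1.mono fun u hu => hu.symm))
  simp at h3

lemma eventually_derivWeierstrassP_ne_zero (L : PeriodPair) :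
    ∀ᶠ u in 𝓝[≠] (0 : ℂ), L.derivWeierstrassP u ≠ 0 := by
  have h1 := L.analyticAt_derivWeierstrassPExcept 0
  have h2 : ContinuousAt (fun u => u ^ 3 * L.derivWeierstrassPExcept 0 u - 2) 0 := by
    have : AnalyticAt ℂ (fun u => u ^ 3 * L.derivWeierstrassPExcept 0 u - 2) 0 := by fun_prop
    exact this.continuousAt
  have h3 : (0 : ℂ) ^ 3 * L.derivWeierstrassPExcept 0 0 - 2 ≠ 0 := by simp
  filter_upwards [mem_nhdsWithin_of_mem_nhds (h2.eventually_ne h3),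
    self_mem_nhdsWithin] with u hu hu0 h
  have hu0 : u ≠ 0 := hu0
  rw [derivWeierstrassP_eq_derivWeierstrassPExcept_sub] at h
  apply hu
  field_simp at h
  linear_combination h

variable (τ : UpperHalfPlane)

lemma not_eventually_quasiZeta_eq {g : ℂ → ℂ} (hg : ContinuousAt g 0) :
    ¬ ∀ᶠ u in 𝓝[≠] (0 : ℂ), quasiZeta τ u = g u := by
  intro h
  obtain ⟨k, hk, hF⟩ := exists_quasiZeta_eq_add τ
  have h1 : ∀ᶠ u in 𝓝[≠] (0 : ℂ), u * (k u - 2 * Real.pi * I * g u) = 1 := by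
    filter_upwards [h, hF, self_mem_nhdsWithin] with u h1 h2 h3
    have h3 : u ≠ 0 := h3
    rw [← h1, h2]
    field_simp
    ring
  have h2 : Tendsto (fun u => u * (k u - 2 * Real.pi * I * g u)) (𝓝[≠] 0)
      (𝓝 (0 * (k 0 - 2 * Real.pi * I * g 0))) := by
    have h3 := hk.continuousAt
    have h4 : ContinuousAt (fun u => u * (k u - 2 * Real.pi * I * g u)) 0 := by fun_prop
    exact h4.tendsto.mono_left nhdsWithin_le_nhds
  have h3 := tendsto_nhds_unique h2 (tendsto_const_nhds.congr' (h1.mono fun u hu => hu.symm))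
  simp at h3

/-- Otherwise the slope formula forces ℘'(u) = ℘'(v), so chords from u and from v to a generic y
agree: F(u) - F(u + y) = F(v) - F(v + y). As y → -u the left side has a pole and the right side does
not. -/
lemma add_mem_or_sub_mem_of_weierstrassP_eq {u v : ℂ} (hu : u ∉ (periods τ).lattice)
    (hv : v ∉ (periods τ).lattice) (h : (periods τ).weierstrassP u = (periods τ).weierstrassP v) :
    u + v ∈ (periods τ).lattice ∨ u - v ∈ (periods τ).lattice := by
  by_contra! hcon
  obtain ⟨hadd, hsub⟩ := hcon
  set L := periods τ
  have hd : L.derivWeierstrassP u = L.derivWeierstrassP v := by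
    have := two_mul_chordSlope_mul τ hu hv hadd
    rw [h, sub_self, mul_zero, mul_zero] at this
    exact (sub_eq_zero.mp this.symm)
  have hvu : v - u ∉ L.lattice := fun hh => hsub (by simpa using neg_mem hh)
  have hnu : -u ∉ L.lattice := fun hh => hu (by simpa using neg_mem hh)
  have hg : ContinuousAt (fun x => quasiZeta τ u - quasiZeta τ v + quasiZeta τ (v - u + x)) 0 := by
    have h1 : ContinuousAt (quasiZeta τ) (v - u + 0) := by
      rw [add_zero]
      exact (analyticAt_quasiZeta τ hvu).continuousAt
    exact continuousAt_const.add (h1.comp (f := fun x => v - u + x) (by fun_prop))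
  refine not_eventually_quasiZeta_eq τ hg ?_
  have htr : ∀ a : ℂ, Tendsto (fun x => a + x) (𝓝[≠] 0) (𝓝[≠] a) := fun a => by
    simpa using tendsto_nhdsNE_of_injective (m := fun x => a + x) (y := 0) (by fun_prop)
      (add_right_injective a)
  filter_upwards [(htr (-u)).eventually (eventually_weierstrassP_ne L hnu (L.weierstrassP u)),
    (htr (-u)).eventually (eventually_notMem_lattice L), eventually_notMem_lattice L,
    (htr (v - u)).eventually (eventually_notMem_lattice L)] with x h1 h2 h3 h4
  have e1 := two_mul_chordSlope_mul τ hu h2 (by simpa using h3)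
  have e2 := two_mul_chordSlope_mul τ hv h2 (by
    rwa [show v + (-u + x) = v - u + x by ring])
  rw [← hd, ← h, ← e1] at e2
  have e3 := mul_right_cancel₀ (sub_ne_zero.mpr h1.symm) (mul_left_cancel₀ two_ne_zero e2)
  have e4 := mul_left_cancel₀ two_pi_I_ne_zero e3
  rw [show v + (-u + x) = v - u + x by ring, show u + (-u + x) = x by ring] at e4
  linear_combination e4

/-! ### The uniformisation is a group homomorphism -/

variable {τ}

lemma Uniformizes.eq_zero_iff {u : ℂ} {P : (curve τ).toAffine.Point} (h : Uniformizes τ u P) :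
    P = 0 ↔ u ∈ (periods τ).lattice := by
  rcases h with ⟨h1, h2⟩ | ⟨h1, hn, h2⟩
  · exact iff_of_true h2 h1
  · refine iff_of_false ?_ h1
    rw [h2]
    exact WeierstrassCurve.Affine.Point.some_ne_zero _

lemma Uniformizes.exists_eq_some {u : ℂ} {P : (curve τ).toAffine.Point} (h : Uniformizes τ u P)
    (hu : u ∉ (periods τ).lattice) :
    ∃ hn, P = .some ((periods τ).weierstrassP u) ((periods τ).derivWeierstrassP u / 2) hn :=
  (h.resolve_left fun h1 => hu h1.1).2

lemma Uniformizes.add_mem {u l : ℂ} {P : (curve τ).toAffine.Point} (h : Uniformizes τ u P)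
    (hl : l ∈ (periods τ).lattice) : Uniformizes τ (u + l) P := by
  rcases h with ⟨h1, h2⟩ | ⟨h1, hn, h2⟩
  · exact .inl ⟨Submodule.add_mem _ h1 hl, h2⟩
  · refine .inr ⟨fun hh => h1 (by simpa using sub_mem hh hl), ?_⟩
    have e1 := (periods τ).weierstrassP_add_coe u ⟨l, hl⟩
    have e2 := (periods τ).derivWeierstrassP_add_coe u ⟨l, hl⟩
    simp only [e1, e2]
    exact ⟨hn, h2⟩

lemma Uniformizes.zero : Uniformizes τ 0 0 := .inl ⟨zero_mem _, rfl⟩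

lemma Uniformizes.neg {u : ℂ} {P : (curve τ).toAffine.Point} (h : Uniformizes τ u P) :
    Uniformizes τ (-u) (-P) := by
  rcases h with ⟨h1, rfl⟩ | ⟨h1, hn, rfl⟩
  · exact .inl ⟨neg_mem h1, neg_zero⟩
  · refine .inr ⟨fun hh => h1 (by simpa using neg_mem hh), ?_⟩
    have e : (curve τ).toAffine.negY ((periods τ).weierstrassP u)
        ((periods τ).derivWeierstrassP u / 2) = (periods τ).derivWeierstrassP (-u) / 2 := by
      simp [curve, neg_div]
    have e' := (WeierstrassCurve.Affine.nonsingular_neg ((periods τ).weierstrassP u)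
      ((periods τ).derivWeierstrassP u / 2)).mpr hn
    simp only [WeierstrassCurve.Affine.Point.neg_some, e, PeriodPair.weierstrassP_neg]
    rw [e] at e'
    exact ⟨e', trivial⟩

lemma Uniformizes.unique {u : ℂ} {P Q : (curve τ).toAffine.Point} (hP : Uniformizes τ u P)
    (hQ : Uniformizes τ u Q) : P = Q := by
  by_cases hu : u ∈ (periods τ).lattice
  · rw [hP.eq_zero_iff.mpr hu, hQ.eq_zero_iff.mpr hu]
  · obtain ⟨_, rfl⟩ := hP.exists_eq_some hu
    obtain ⟨_, rfl⟩ := hQ.exists_eq_some hu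
    rfl

/-- Where ℘' ≠ 0 the partial derivative in y is nonzero, so nonsingularity needs no knowledge of the
discriminant. -/
lemma exists_uniformizes {u : ℂ} (hu : u ∉ (periods τ).lattice)
    (hd : (periods τ).derivWeierstrassP u ≠ 0) : ∃ P, Uniformizes τ u P := by
  suffices h : (curve τ).toAffine.Nonsingular ((periods τ).weierstrassP u)
      ((periods τ).derivWeierstrassP u / 2) from ⟨.some _ _ h, .inr ⟨hu, h, rfl⟩⟩
  rw [WeierstrassCurve.Affine.nonsingular_iff, WeierstrassCurve.Affine.equation_iff]
  constructor
  · simp only [curve]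
    linear_combination (periods τ).derivWeierstrassP_sq u hu / 4
  · right
    intro h
    apply hd
    simp only [curve] at h
    linear_combination h

/-- Dividing differences of the cubic equations by xᵢ - xⱼ, then once more, yields s² = x₁ + x₂ +
x₃. -/
lemma collinear_third_x {F : Type*} [Field F] {a b s x₁ x₂ x₃ y₁ y₂ y₃ : F}
    (e₁ : y₁ ^ 2 = x₁ ^ 3 + a * x₁ + b) (e₂ : y₂ ^ 2 = x₂ ^ 3 + a * x₂ + b)
    (e₃ : y₃ ^ 2 = x₃ ^ 3 + a * x₃ + b) (h₂ : s * (x₁ - x₂) = y₁ - y₂)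
    (h₃ : s * (x₁ - x₃) = y₁ - y₃) (h₁₂ : x₁ ≠ x₂) (h₁₃ : x₁ ≠ x₃) (h₂₃ : x₂ ≠ x₃) :
    x₃ = s ^ 2 - x₁ - x₂ := by
  have k₂ : s * (y₁ + y₂) = x₁ ^ 2 + x₁ * x₂ + x₂ ^ 2 + a := by
    apply mul_left_cancel₀ (sub_ne_zero.mpr h₁₂)
    linear_combination (y₁ + y₂) * h₂ + e₁ - e₂
  have k₃ : s * (y₁ + y₃) = x₁ ^ 2 + x₁ * x₃ + x₃ ^ 2 + a := by
    apply mul_left_cancel₀ (sub_ne_zero.mpr h₁₃)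
    linear_combination (y₁ + y₃) * h₃ + e₁ - e₃
  apply mul_left_cancel₀ (sub_ne_zero.mpr h₂₃)
  linear_combination s * (h₂ - h₃) + k₃ - k₂

/-- The points with parameters u, v and -(u + v) lie on one line of slope S. The lattice exclusions
make their x-coordinates distinct, so only the secant case of the group law arises. -/
lemma Uniformizes.add_of_generic {u v : ℂ} {P Q : (curve τ).toAffine.Point}
    (hP : Uniformizes τ u P) (hQ : Uniformizes τ v Q) (hu : u ∉ (periods τ).lattice)
    (hv : v ∉ (periods τ).lattice) (huv : u + v ∉ (periods τ).lattice)
    (hsub : u - v ∉ (periods τ).lattice) (h2u : 2 * u + v ∉ (periods τ).lattice)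
    (h2v : u + 2 * v ∉ (periods τ).lattice) : Uniformizes τ (u + v) (P + Q) := by
  obtain ⟨hn₁, rfl⟩ := hP.exists_eq_some hu
  obtain ⟨hn₂, rfl⟩ := hQ.exists_eq_some hv
  set L := periods τ with hL
  have hne : ∀ {a b : ℂ}, a ∉ L.lattice → b ∉ L.lattice → a + b ∉ L.lattice → a - b ∉ L.lattice →
      L.weierstrassP a ≠ L.weierstrassP b := fun ha hb h1 h2 h =>
    (add_mem_or_sub_mem_of_weierstrassP_eq τ ha hb h).elim h1 h2
  have hneg : ∀ {a : ℂ}, a ∉ L.lattice → -a ∉ L.lattice := fun ha h => ha (by simpa using neg_mem h)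
  have h₁₂ := hne hu hv huv hsub
  have h₁₃ := hne hu huv (notMem_of_eq h2u (by ring)) (notMem_of_eq (hneg hv) (by ring))
  have h₂₃ := hne hv huv (notMem_of_eq h2v (by ring)) (notMem_of_eq (hneg hu) (by ring))
  have c₂ := two_mul_chordSlope_mul τ hu hv huv
  have c₃ := two_mul_chordSlope_mul τ hu (hneg huv) (notMem_of_eq (hneg hv) (by ring))
  have hS : chordSlope τ u (-(u + v)) = chordSlope τ u v := by
    rw [chordSlope, chordSlope, show u + -(u + v) = -v by ring, quasiZeta_neg, quasiZeta_neg]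
    ring
  rw [hS, L.weierstrassP_neg, L.derivWeierstrassP_neg] at c₃
  have hx := collinear_third_x (a := -L.g₂ / 4) (b := -L.g₃ / 4) (s := chordSlope τ u v)
    (x₁ := L.weierstrassP u) (x₂ := L.weierstrassP v) (x₃ := L.weierstrassP (u + v))
    (y₁ := L.derivWeierstrassP u / 2) (y₂ := L.derivWeierstrassP v / 2)
    (y₃ := -L.derivWeierstrassP (u + v) / 2)
    (by linear_combination L.derivWeierstrassP_sq u hu / 4)
    (by linear_combination L.derivWeierstrassP_sq v hv / 4)
    (by linear_combination L.derivWeierstrassP_sq (u + v) huv / 4)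
    (by linear_combination c₂ / 2) (by linear_combination c₃ / 2) h₁₂ h₁₃ h₂₃
  have hs : (curve τ).toAffine.slope (L.weierstrassP u) (L.weierstrassP v)
      (L.derivWeierstrassP u / 2) (L.derivWeierstrassP v / 2) = chordSlope τ u v := by
    rw [WeierstrassCurve.Affine.slope_of_X_ne h₁₂, div_eq_iff (sub_ne_zero.mpr h₁₂)]
    linear_combination -c₂ / 2
  refine .inr ⟨huv, ?_⟩
  rw [WeierstrassCurve.Affine.Point.add_of_X_ne h₁₂]
  have hX : (curve τ).toAffine.addX (L.weierstrassP u) (L.weierstrassP v)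
      ((curve τ).toAffine.slope (L.weierstrassP u) (L.weierstrassP v)
      (L.derivWeierstrassP u / 2) (L.derivWeierstrassP v / 2)) = L.weierstrassP (u + v) := by
    rw [hs, hx]
    simp [WeierstrassCurve.Affine.addX, curve]
  have hY : (curve τ).toAffine.addY (L.weierstrassP u) (L.weierstrassP v)
      (L.derivWeierstrassP u / 2)
      ((curve τ).toAffine.slope (L.weierstrassP u) (L.weierstrassP v)
      (L.derivWeierstrassP u / 2) (L.derivWeierstrassP v / 2)) =
      L.derivWeierstrassP (u + v) / 2 := by
    rw [WeierstrassCurve.Affine.addY, WeierstrassCurve.Affine.negAddY, hX, hs]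
    simp only [WeierstrassCurve.Affine.negY, curve]
    linear_combination c₃ / 2
  have hns := WeierstrassCurve.Affine.nonsingular_add hn₁ hn₂ fun hxy => h₁₂ hxy.left
  have key : ∀ {x y x' y' : ℂ} (h : (curve τ).toAffine.Nonsingular x y) (_ : x = x') (_ : y = y'),
      ∃ h', WeierstrassCurve.Affine.Point.some x y h
        = (WeierstrassCurve.Affine.Point.some x' y' h' : (curve τ).toAffine.Point) := by
    rintro x y _ _ h rfl rfl
    exact ⟨h, rfl⟩
  exact key hns hX hY

lemma eventually_add_mul_notMem_lattice (L : PeriodPair) (a : ℂ) {m : ℂ} (hm : m ≠ 0) :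
    ∀ᶠ r in 𝓝[≠] (0 : ℂ), a + m * r ∉ L.lattice := by
  have := tendsto_nhdsNE_of_injective (m := fun r => a + m * r) (y := 0) (by fun_prop)
    ((add_right_injective a).comp (mul_right_injective₀ hm))
  exact this.eventually (eventually_notMem_lattice L)

/-- Degenerate pairs, tangents included, reduce to the generic case by writing P + Q = (P + R) + (Q
- R), with R of small generic parameter r. -/
lemma Uniformizes.add {u v : ℂ} {P Q : (curve τ).toAffine.Point}
    (hP : Uniformizes τ u P) (hQ : Uniformizes τ v Q) : Uniformizes τ (u + v) (P + Q) := by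
  by_cases hu : u ∈ (periods τ).lattice
  · rw [hP.eq_zero_iff.mpr hu, zero_add, add_comm]
    exact hQ.add_mem hu
  by_cases hv : v ∈ (periods τ).lattice
  · rw [hQ.eq_zero_iff.mpr hv, add_zero]
    exact hP.add_mem hv
  by_cases huv : u + v ∈ (periods τ).lattice
  · have h1 := hP.neg.add_mem huv
    rw [neg_add_cancel_left] at h1
    rw [hQ.unique h1, add_neg_cancel]
    exact .inl ⟨huv, rfl⟩
  have ev := fun (a m : ℂ) (hm : m ≠ 0) => eventually_add_mul_notMem_lattice (periods τ) a hm
  have n1 : (1 : ℂ) ≠ 0 := one_ne_zero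
  have n2 : (2 : ℂ) ≠ 0 := two_ne_zero
  have m1 : (-1 : ℂ) ≠ 0 := neg_ne_zero.mpr n1
  have m2 : (-2 : ℂ) ≠ 0 := neg_ne_zero.mpr n2
  have hev : ∀ᶠ r in 𝓝[≠] (0 : ℂ), ∃ R S T : (curve τ).toAffine.Point,
      Uniformizes τ r R ∧ Uniformizes τ (u + r) S ∧ S = P + R ∧ Uniformizes τ (v + -r) T ∧
        T = Q + -R ∧ Uniformizes τ (u + r + (v + -r)) (S + T) := by
    filter_upwards [eventually_derivWeierstrassP_ne_zero (periods τ),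
      eventually_notMem_lattice (periods τ), ev u 1 n1, ev u (-1) m1, ev (2 * u) 1 n1, ev u 2 n2,
      ev v 1 n1, ev v (-1) m1, ev (2 * v) (-1) m1, ev v (-2) m2, ev (u - v) 2 n2,
      ev (2 * u + v) 1 n1, ev (u + 2 * v) (-1) m1] with r hd h0 a1 a2 a3 a4 b1 b2 b3 b4 c1 c2 c3
    obtain ⟨R, hR⟩ := exists_uniformizes h0 hd
    have hr : -r ∉ (periods τ).lattice := fun h => h0 (by simpa using neg_mem h)
    have hS := hP.add_of_generic hR hu h0 (notMem_of_eq a1 (by ring))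
      (notMem_of_eq a2 (by ring)) (notMem_of_eq a3 (by ring)) a4
    have hT := hQ.add_of_generic hR.neg hv hr (notMem_of_eq b2 (by ring))
      (notMem_of_eq b1 (by ring)) (notMem_of_eq b3 (by ring)) (notMem_of_eq b4 (by ring))
    refine ⟨R, _, _, hR, hS, rfl, hT, rfl, hS.add_of_generic hT (notMem_of_eq a1 (by ring))
      (notMem_of_eq b2 (by ring)) (notMem_of_eq huv (by ring)) (notMem_of_eq c1 (by ring))
      (notMem_of_eq c2 (by ring)) (notMem_of_eq c3 (by ring))⟩
  obtain ⟨r, R, S, T, -, -, rfl, -, rfl, h⟩ := hev.exists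
  convert h using 1
  · ring
  · abel

lemma Uniformizes.nsmul {u : ℂ} {P : (curve τ).toAffine.Point} (hP : Uniformizes τ u P) (n : ℕ) :
    Uniformizes τ (n * u) (n • P) := by
  induction n with
  | zero => simpa using Uniformizes.zero
  | succ n ih =>
    rw [succ_nsmul]
    convert ih.add hP using 1
    push_cast
    ring

lemma Uniformizes.zsmul {u : ℂ} {P : (curve τ).toAffine.Point} (hP : Uniformizes τ u P) (n : ℤ) :
    Uniformizes τ (n * u) (n • P) := by
  obtain ⟨m, rfl | rfl⟩ := n.eq_nat_or_neg
  · simpa using hP.nsmul m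
  · simpa using (hP.nsmul m).neg

end Uniformization

section LevelStructure

/-! ### The value of `f₁` in terms of `F` -/

lemma sum_zmod_eq_sum_range {M : Type*} [AddCommMonoid M] {N : ℕ} [NeZero N] (f : ZMod N → M) :
    ∑ x, f x = ∑ i ∈ Finset.range N, f (i : ZMod N) := by
  refine Finset.sum_nbij' (fun x => x.val) (fun i => (i : ZMod N)) ?_ ?_ ?_ ?_ ?_
  · exact fun x _ => Finset.mem_range.mpr x.val_lt
  · exact fun _ _ => Finset.mem_univ _
  · exact fun x _ => ZMod.natCast_rightInverse x
  · exact fun i hi => ZMod.val_cast_of_lt (Finset.mem_range.mp hi)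
  · exact fun x _ => by rw [ZMod.natCast_rightInverse x]

variable {τ : UpperHalfPlane} {N : ℕ} {β : LevelStructure N (curve τ)} {k : ℤ}

lemma uniformizes_level (h₁ : Uniformizes τ ((τ : ℂ) / N) (β (1, 0) : (curve τ).toAffine.Point))
    (h₂ : Uniformizes τ ((k : ℂ) / N) (β (0, 1) : (curve τ).toAffine.Point)) (a b : ℤ) :
    Uniformizes τ ((a * τ + b * k) / N)
      (β ((a : ZMod N), (b : ZMod N)) : (curve τ).toAffine.Point) := by
  have e : (((a : ZMod N), (b : ZMod N)) : ZMod N × ZMod N) = a • (1, 0) + b • (0, 1) := by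
    ext <;> simp
  have := (h₁.zsmul a).add (h₂.zsmul b)
  rw [e, map_add, map_zsmul, map_zsmul]
  convert this using 1
  · ring
  · rfl

lemma lineSlope_eq_chordSlope {u v : ℂ} {P Q : (curve τ).toAffine.Point}
    (hP : Uniformizes τ u P) (hQ : Uniformizes τ v Q) (hP0 : P ≠ 0) (hQ0 : Q ≠ 0)
    (hadd : P + Q ≠ 0) (hne : P ≠ Q) : lineSlope P Q = chordSlope τ u v := by
  have hu : u ∉ (periods τ).lattice := fun h => hP0 (hP.eq_zero_iff.mpr h)
  have hv : v ∉ (periods τ).lattice := fun h => hQ0 (hQ.eq_zero_iff.mpr h)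
  have huv : u + v ∉ (periods τ).lattice := fun h => hadd ((hP.add hQ).eq_zero_iff.mpr h)
  obtain ⟨hn₁, rfl⟩ := hP.exists_eq_some hu
  obtain ⟨hn₂, rfl⟩ := hQ.exists_eq_some hv
  have hx : (periods τ).weierstrassP u ≠ (periods τ).weierstrassP v := fun h =>
    (WeierstrassCurve.Affine.Point.X_eq_iff (h₁ := hn₁) (h₂ := hn₂)).mp h |>.elim hne
      fun h => hadd (by rw [h, neg_add_cancel])
  simp only [lineSlope]
  rw [WeierstrassCurve.Affine.slope_of_X_ne hx, div_eq_iff (sub_ne_zero.mpr hx)]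
  linear_combination -two_mul_chordSlope_mul τ hu hv huv / 2

lemma f₁_eq_quasiZeta [NeZero N]
    (h₁ : Uniformizes τ ((τ : ℂ) / N) (β (1, 0) : (curve τ).toAffine.Point))
    (h₂ : Uniformizes τ ((k : ℂ) / N) (β (0, 1) : (curve τ).toAffine.Point)) (c : ℕ) (d : ℤ)
    {v w : ZMod N × ZMod N} (hv : v = ((c : ZMod N), (d : ZMod N))) (hv0 : v ≠ 0)
    (hw : w ∉ AddSubgroup.zmultiples v) :
    f₁ β v w = 2 * Real.pi * I * (quasiZeta τ ((c * τ + d * k) / N) - c / N) := by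
  have hN : (N : ℂ) ≠ 0 := Nat.cast_ne_zero.mpr (NeZero.ne N)
  obtain ⟨a, ha⟩ := ZMod.intCast_surjective w.1
  obtain ⟨b, hb⟩ := ZMod.intCast_surjective w.2
  set U : ℂ := (c * τ + d * k) / N with hU
  set V : ℂ := (a * τ + b * k) / N with hV
  have huv : Uniformizes τ U (β v : (curve τ).toAffine.Point) := by
    have := uniformizes_level h₁ h₂ c d
    rw [hv]
    simpa using this
  have huw : ∀ i : ℕ, Uniformizes τ (V + i * U)
      (β (w + (i : ZMod N) • v) : (curve τ).toAffine.Point) := by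
    intro i
    have := uniformizes_level h₁ h₂ (a + i * c) (b + i * d)
    convert this using 3
    · rw [hV, hU]
      push_cast
      ring
    · rw [hv]
      ext <;> simp [← ha, ← hb]
  have hβ : ∀ x y : ZMod N × ZMod N,
      (β x : (curve τ).toAffine.Point) = β y → x = y := fun x y h => β.injective (Subtype.ext h)
  have hβ0 : ∀ x : ZMod N × ZMod N, (β x : (curve τ).toAffine.Point) = 0 → x = 0 := fun x h =>
    hβ x 0 (by rw [h, map_zero]; rfl)
  have hmul : ∀ i : ℕ, (i : ZMod N) • v ∈ AddSubgroup.zmultiples v := fun i => by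
    rw [Nat.cast_smul_eq_nsmul]
    exact AddSubgroup.nsmul_mem_zmultiples v i
  have hself := AddSubgroup.mem_zmultiples v
  have hterm : ∀ i : ℕ, lineSlope (β v : (curve τ).toAffine.Point)
      (β (w + (i : ZMod N) • v) : (curve τ).toAffine.Point) =
      2 * Real.pi * I * (quasiZeta τ U -
        (quasiZeta τ (V + (i + 1 : ℕ) * U) - quasiZeta τ (V + i * U))) := by
    -- Since w is not a multiple of v, the two points are finite, distinct and not opposite: every
    -- line is a non-vertical secant.
    intro i
    have hi := hmul i
    rw [lineSlope_eq_chordSlope huv (huw i) (fun h => hv0 (hβ0 _ h))]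
    · rw [chordSlope]
      push_cast
      ring_nf
    · intro h
      refine hw ?_
      rw [eq_neg_of_add_eq_zero_left (hβ0 _ h)]
      exact neg_mem hi
    · intro h
      have h' : ((β (v + (w + (i : ZMod N) • v)) : AddSubgroup.torsionBy _ _) :
        (curve τ).toAffine.Point) = 0 := by
        rw [map_add]
        exact h
      refine hw ?_
      have : w = -(v + (i : ZMod N) • v) := by linear_combination hβ0 _ h'
      rw [this]
      exact neg_mem (add_mem hself hi)
    · intro h
      refine hw ?_
      rw [← sub_eq_of_eq_add (hβ _ _ h)]
      exact sub_mem hself hi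
  have hper : quasiZeta τ (V + N * U) = quasiZeta τ V + c := by
    have := quasiZeta_add_int_mul_tau τ (V + (d * k : ℤ)) c
    rw [quasiZeta_add_int] at this
    rw [show V + N * U = V + (d * k : ℤ) + (c : ℤ) * τ by rw [hU]; push_cast; field_simp; ring, this]
    simp
  rw [f₁, sum_zmod_eq_sum_range, Finset.sum_congr rfl fun i _ => hterm i, ← Finset.mul_sum,
    Finset.sum_sub_distrib, Finset.sum_range_sub (fun i : ℕ => quasiZeta τ (V + i * U)), hper]
  simp only [Finset.sum_const, Finset.card_range, nsmul_eq_mul, Nat.cast_zero, zero_mul, add_zero]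
  field_simp
  ring

end LevelStructure

section QExpansion

/-! ### Lambert series and the `q`-expansion -/

lemma hasSum_pnat_geometric {s : ℂ} (hs : ‖s‖ < 1) :
    HasSum (fun b : ℕ+ => s ^ (b : ℕ)) (geomKernel s) := by
  have hs1 : s ≠ 1 := by
    rintro rfl
    simp at hs
  rw [geomKernel_eq hs1, ← Equiv.pnatEquivNat.symm.hasSum_iff]
  have := (hasSum_geometric_of_norm_lt_one hs).mul_left s
  rw [← div_eq_mul_inv] at this
  have h : (fun b : ℕ+ => s ^ (b : ℕ)) ∘ Equiv.pnatEquivNat.symm = fun n : ℕ => s * s ^ n :=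
    funext fun n => pow_succ' s n
  rwa [h]

/-- The contribution of the pairs `(a, b)` with `a ≡ s mod N` to the Lambert series. -/
def residueTerm (N : ℕ) (s : ℤ) (ζ p : ℂ) (a b : ℕ) : ℂ :=
  if (a : ℤ) ≡ s [ZMOD (N : ℤ)] then ζ ^ b * p ^ (a * b) else 0

/-- Summing over b first gives a geometric kernel for each a. With 1 ≤ r ≤ N the positive a in the
class are exactly the Nn + r, n ≥ 0; the class of 0 is represented by r = N. -/
lemma hasSum_residueTerm {N r : ℕ} {s : ℤ} (hr : 0 < r) (hrN : r ≤ N)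
    (hrs : (r : ℤ) ≡ s [ZMOD (N : ℤ)]) {ζ p : ℂ} (hζ : ‖ζ‖ ≤ 1) (hp : ‖p‖ < 1) :
    HasSum (fun x : ℕ+ × ℕ+ => residueTerm N s ζ p x.1 x.2)
      (∑' n : ℕ, geomKernel (p ^ (N * n + r) * ζ)) := by
  have hsum : Summable fun x : ℕ+ × ℕ+ => residueTerm N s ζ p x.1 x.2 := by
    have h1 : Summable fun x : ℕ+ × ℕ+ => ‖p‖ ^ (x.1 * x.2 : ℕ) := by
      simpa using summable_prod_mul_pow (𝕜 := ℝ) 0 (r := ‖p‖) (by simpa using hp)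
    refine h1.of_norm_bounded fun x => ?_
    unfold residueTerm
    split_ifs
    · rw [norm_mul, norm_pow, norm_pow]
      exact mul_le_of_le_one_left (by positivity) (pow_le_one₀ (norm_nonneg _) hζ)
    · simp
  set g : ℕ+ → ℂ := fun a =>
    if ((a : ℕ) : ℤ) ≡ s [ZMOD (N : ℤ)] then geomKernel (p ^ (a : ℕ) * ζ) else 0 with hg
  have h2 : HasSum g (∑' x : ℕ+ × ℕ+, residueTerm N s ζ p x.1 x.2) := by
    refine hsum.hasSum.prod_fiberwise fun a => ?_
    simp only [hg, residueTerm]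
    split_ifs
    · have h3 : ‖p ^ (a : ℕ) * ζ‖ < 1 := by
        rw [norm_mul, norm_pow]
        exact mul_lt_one_of_nonneg_of_lt_one_left (by positivity)
          (pow_lt_one₀ (norm_nonneg _) hp a.ne_zero) hζ
      convert hasSum_pnat_geometric h3 using 2 with b
      rw [mul_pow, ← pow_mul, mul_comm]
    · exact hasSum_zero
  set i : ℕ → ℕ+ := fun n => ⟨N * n + r, by omega⟩ with hi
  have hinj : Function.Injective i := by
    intro m n h
    have h4 : N * m + r = N * n + r := congrArg PNat.val h
    have h5 : 0 < N := by omega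
    exact Nat.eq_of_mul_eq_mul_left h5 (Nat.add_right_cancel h4)
  have hrange : ∀ a ∉ Set.range i, g a = 0 := by
    intro a ha
    refine if_neg fun h => ha ?_
    have h4 : ((a : ℕ) : ℤ) ≡ r [ZMOD N] := h.trans hrs.symm
    obtain ⟨m, hm⟩ := h4.symm.dvd
    have ha0 : 0 < (a : ℕ) := a.pos
    have hm0 : 0 ≤ m := by
      by_contra! hneg
      have : (N : ℤ) * m ≤ N * (-1) := by
        apply mul_le_mul_of_nonneg_left <;> omega
      omega
    lift m to ℕ using hm0
    refine ⟨m, PNat.eq ?_⟩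
    simp only [hi, PNat.mk_coe]
    zify
    linarith
  have h6 := (hinj.hasSum_iff hrange).mpr h2
  have h7 : g ∘ i = fun n : ℕ => geomKernel (p ^ (N * n + r) * ζ) := by
    funext n
    refine if_pos ?_
    refine Int.ModEq.trans ?_ hrs
    simp only [hi, PNat.mk_coe]
    push_cast
    exact Int.modEq_iff_dvd.mpr ⟨-n, by ring⟩
  rw [h7] at h6
  rw [h6.tsum_eq]
  exact hsum.hasSum

lemma hasSum_pnat_of_hasSum_prod {f : ℕ → ℕ → ℂ} {A : ℂ}
    (h : HasSum (fun x : ℕ+ × ℕ+ => f x.1 x.2) A) :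
    HasSum (fun n : ℕ => ∑ x ∈ (n + 1).divisorsAntidiagonal, f x.1 x.2) A := by
  have h1 := (sigmaAntidiagonalEquivProd.hasSum_iff).mpr h
  have h2 := h1.sigma fun n => hasSum_fintype _
  rw [← Equiv.pnatEquivNat.symm.hasSum_iff] at h2
  convert h2 using 2 with n
  rw [← Finset.sum_coe_sort]
  rfl

/-- As ab = n > 0, both factors have the same sign. Negating the negative pairs turns a ≡ c into a ≡
-c, inverts z^d and produces the minus sign. -/
lemma coeff_mul_pow_eq_sum {N c : ℕ} {d : ℤ} {z : ℂ} (p : ℂ) {n : ℕ} (hn : n ≠ 0) :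
    coeff N z c d n * p ^ n = ∑ x ∈ n.divisorsAntidiagonal,
      (residueTerm N c (z ^ d) p x.1 x.2 - residueTerm N (-c) (z ^ d)⁻¹ p x.1 x.2) := by
  have hn0 : (0 : ℤ) < n := by omega
  have hpos : ∀ x ∈ n.divisorsAntidiagonal, 0 < x.1 ∧ 0 < x.2 ∧ x.1 ≤ n ∧ x.2 ≤ n ∧ x.1 * x.2 = n := by
    intro x hx
    have h1 := (Nat.mem_divisorsAntidiagonal.mp hx).1
    have h2 : 0 < x.1 := Nat.pos_of_ne_zero fun h => hn (by rw [← h1, h, zero_mul])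
    have h3 : 0 < x.2 := Nat.pos_of_ne_zero fun h => hn (by rw [← h1, h, mul_zero])
    exact ⟨h2, h3, h1 ▸ Nat.le_mul_of_pos_right _ h3, h1 ▸ Nat.le_mul_of_pos_left _ h2, h1⟩
  rw [coeff, if_neg hn, Finset.sum_sub_distrib,
    ← Finset.sum_filter_add_sum_filter_not _ (fun p : ℤ × ℤ => 0 < p.2), add_mul, sub_eq_add_neg,
    ← Finset.sum_neg_distrib]
  congr 1
  · simp only [residueTerm, ← Finset.sum_filter, Finset.sum_mul]
    refine Finset.sum_nbij' (fun x => (x.1.toNat, x.2.toNat)) (fun x => ((x.1 : ℤ), (x.2 : ℤ)))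
      ?_ ?_ ?_ ?_ ?_
    · rintro ⟨a, b⟩ h
      simp only [Finset.mem_filter] at h
      obtain ⟨⟨-, h1, h2⟩, h3⟩ := h
      have ha : 0 < a := pos_of_mul_pos_left (h1 ▸ hn0) h3.le
      lift a to ℕ using ha.le
      lift b to ℕ using h3.le
      simp only [Finset.mem_filter, Nat.mem_divisorsAntidiagonal, Int.toNat_natCast]
      exact ⟨⟨by exact_mod_cast h1, hn⟩, h2⟩
    · rintro ⟨a, b⟩ h
      obtain ⟨hx, h2⟩ := Finset.mem_filter.mp h
      obtain ⟨h3, h4, h5, h6, h7⟩ := hpos _ hx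
      simp only at h3 h4 h5 h6 h7 h2
      simp only [Finset.mem_filter, Finset.mem_product, Finset.mem_Icc]
      refine ⟨⟨⟨⟨?_, ?_⟩, ?_, ?_⟩, by exact_mod_cast h7, h2⟩, ?_⟩ <;> omega
    · rintro ⟨a, b⟩ h
      simp only [Finset.mem_filter] at h
      obtain ⟨⟨-, h1, -⟩, h3⟩ := h
      have ha : 0 < a := pos_of_mul_pos_left (h1 ▸ hn0) h3.le
      ext <;> simp only <;> omega
    · rintro ⟨a, b⟩ h
      rfl
    · rintro ⟨a, b⟩ h
      simp only [Finset.mem_filter] at h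
      obtain ⟨⟨-, h1, -⟩, h3⟩ := h
      have ha : 0 < a := pos_of_mul_pos_left (h1 ▸ hn0) h3.le
      lift a to ℕ using ha.le
      lift b to ℕ using h3.le
      have h4 : a * b = n := by exact_mod_cast h1
      simp only [Int.toNat_natCast, Int.sign_eq_one_of_pos h3, h4]
      rw [mul_comm (b : ℤ), zpow_mul, zpow_natCast]
      simp
  · simp only [residueTerm, Finset.sum_neg_distrib, ← Finset.sum_filter, Finset.sum_mul]
    rw [← Finset.sum_neg_distrib]
    refine Finset.sum_nbij' (fun x => ((-x.1).toNat, (-x.2).toNat))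
      (fun x => (-(x.1 : ℤ), -(x.2 : ℤ))) ?_ ?_ ?_ ?_ ?_
    · rintro ⟨a, b⟩ h
      simp only [Finset.mem_filter] at h
      obtain ⟨⟨-, h1, h2⟩, h3⟩ := h
      obtain ⟨a, rfl⟩ : ∃ a', a = -a' := ⟨-a, (neg_neg a).symm⟩
      obtain ⟨b, rfl⟩ : ∃ b', b = -b' := ⟨-b, (neg_neg b).symm⟩
      rw [neg_mul_neg] at h1
      have hb : 0 ≤ b := by omega
      have ha : 0 < a := pos_of_mul_pos_left (h1 ▸ hn0) hb
      lift a to ℕ using ha.le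
      lift b to ℕ using hb
      simp only [Finset.mem_filter, Nat.mem_divisorsAntidiagonal, neg_neg, Int.toNat_natCast]
      exact ⟨⟨by exact_mod_cast h1, hn⟩, by simpa using h2.neg⟩
    · rintro ⟨a, b⟩ h
      obtain ⟨hx, h2⟩ := Finset.mem_filter.mp h
      obtain ⟨h3, h4, h5, h6, h7⟩ := hpos _ hx
      simp only at h3 h4 h5 h6 h7 h2
      simp only [Finset.mem_filter, Finset.mem_product, Finset.mem_Icc]
      refine ⟨⟨⟨⟨?_, ?_⟩, ?_, ?_⟩, ?_, by simpa using h2.neg⟩, ?_⟩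
      · omega
      · omega
      · omega
      · omega
      · rw [neg_mul_neg]
        exact_mod_cast h7
      · omega
    · rintro ⟨a, b⟩ h
      simp only [Finset.mem_filter] at h
      obtain ⟨⟨-, h1, -⟩, h3⟩ := h
      have hb : 0 ≤ -b := by omega
      have ha : 0 < -a := pos_of_mul_pos_left (by rw [neg_mul_neg]; exact h1 ▸ hn0) hb
      ext <;> simp only <;> omega
    · rintro ⟨a, b⟩ h
      simp
    · rintro ⟨a, b⟩ h
      simp only [Finset.mem_filter] at h
      obtain ⟨⟨-, h1, -⟩, h3⟩ := h
      obtain ⟨a, rfl⟩ : ∃ a', a = -a' := ⟨-a, (neg_neg a).symm⟩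
      obtain ⟨b, rfl⟩ : ∃ b', b = -b' := ⟨-b, (neg_neg b).symm⟩
      rw [neg_mul_neg] at h1
      have hb : 0 ≤ b := by omega
      have ha : 0 < a := pos_of_mul_pos_left (h1 ▸ hn0) hb
      have hb' : 0 < b := pos_of_mul_pos_right (h1 ▸ hn0) ha.le
      lift a to ℕ using ha.le
      lift b to ℕ using hb
      have h4 : a * b = n := by exact_mod_cast h1
      simp only [neg_neg, Int.toNat_natCast, Int.sign_neg, Int.sign_eq_one_of_pos hb', h4]
      rw [neg_mul, mul_comm (b : ℤ), zpow_neg, zpow_mul, zpow_natCast, inv_pow]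
      simp

variable {τ : UpperHalfPlane}

lemma hasSum_coeff {N c : ℕ} {d k : ℤ} {z : ℂ} (hc : c < N)
    (hz : z = expPeriod (k / N)) :
    HasSum (fun n : ℕ => coeff N z c d n * qN N τ ^ n)
      (quasiZeta τ ((c * τ + d * k) / N) - c / N) := by
  have hN : (N : ℂ) ≠ 0 := Nat.cast_ne_zero.mpr (by omega)
  set p := qN N τ with hp
  have hpe : p = expPeriod (τ / N) := by
    rw [hp, qN, expPeriod, mul_div_assoc]
  have hpow : ∀ (u : ℂ) (n : ℕ), expPeriod u ^ n = expPeriod (n * u) := fun u n => by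
    rw [expPeriod, ← exp_nat_mul, expPeriod]
    ring_nf
  have hq : p ^ N = expPeriod τ := by
    rw [hpe, hpow, mul_div_cancel₀ _ hN]
  have hp0 : p ≠ 0 := hpe ▸ expPeriod_ne_zero _
  have hq1 := norm_expPeriod_lt_one τ
  have hp1 : ‖p‖ < 1 := by
    rw [← hq, norm_pow] at hq1
    exact lt_of_pow_lt_pow_left₀ N zero_le_one (by simpa using hq1)
  have hz1 : ‖z‖ = 1 := by
    rw [hz, norm_expPeriod]
    simp
  have hzd : ‖z ^ d‖ = 1 := by rw [norm_zpow, hz1, one_zpow]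
  have hzd0 : z ^ d ≠ 0 := norm_ne_zero_iff.mp (by rw [hzd]; exact one_ne_zero)
  have ht : expPeriod ((c * τ + d * k) / N) = p ^ c * z ^ d := by
    have h1 : z ^ d = expPeriod (d * (k / N)) := by
      rw [hz, expPeriod, ← exp_int_mul, expPeriod]
      ring_nf
    rw [h1, hpe, hpow, ← expPeriod_add]
    ring_nf
  -- With t = p^c z^d, the negative pairs use r = N - c, and p^(Nn + N - c) z^(-d) = q^(n+1) t⁻¹.
  have hB : HasSum (fun x : ℕ+ × ℕ+ => residueTerm N (-c) (z ^ d)⁻¹ p x.1 x.2)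
      (lambertSum (expPeriod τ) (expPeriod ((c * τ + d * k) / N))⁻¹) := by
    have := hasSum_residueTerm (N := N) (r := N - c) (s := -c) (by omega) (by omega)
      (Int.modEq_iff_dvd.mpr ⟨-1, by push_cast [hc.le]; ring⟩) (ζ := (z ^ d)⁻¹)
      (by rw [norm_inv, hzd, inv_one]) hp1
    convert this using 1
    refine tsum_congr fun n => ?_
    rw [ht, ← hq, mul_inv, ← pow_mul, ← mul_assoc]
    congr 2
    rw [← div_eq_mul_inv, div_eq_iff (pow_ne_zero _ hp0), ← pow_add]
    congr 1
    rw [mul_add]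
    omega
  have hA : ∃ A, HasSum (fun x : ℕ+ × ℕ+ => residueTerm N c (z ^ d) p x.1 x.2) A ∧
      coeff N z c d 0 + A = 1 / 2 + geomKernel (expPeriod ((c * τ + d * k) / N)) +
        lambertSum (expPeriod τ) (expPeriod ((c * τ + d * k) / N)) - c / N := by
    rw [ht]
    -- For c = 0 the kernel at t = z^d carries no power of p and belongs to a₀. For c > 0 it is the
    -- term a = c of the series, leaving a₀ = 1/2 - c/N.
    rcases Nat.eq_zero_or_pos c with rfl | hc0
    · refine ⟨_, hasSum_residueTerm (r := N) (by omega) le_rfl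
        (Int.modEq_iff_dvd.mpr ⟨-1, by push_cast; ring⟩) hzd.le hp1, ?_⟩
      have h1 : ∑' n : ℕ, geomKernel (p ^ (N * n + N) * z ^ d)
          = lambertSum (expPeriod τ) (z ^ d) := by
        refine tsum_congr fun n => ?_
        rw [← hq, ← pow_mul, mul_add, mul_one]
      rw [h1, coeff, if_pos rfl, if_pos rfl, geomKernel]
      simp
    · refine ⟨_, hasSum_residueTerm (r := c) hc0 hc.le rfl hzd.le hp1, ?_⟩
      have h1 : ∀ n : ℕ, geomKernel (p ^ (N * n + c) * z ^ d)
          = geomKernel (expPeriod τ ^ n * (p ^ c * z ^ d)) := by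
        intro n
        rw [← hq, ← pow_mul, pow_add, mul_assoc]
      have h2 := (summable_nat_add_iff (f := fun n : ℕ =>
        geomKernel (expPeriod τ ^ n * (p ^ c * z ^ d))) 1).mp (summable_lambertSum hq1 _)
      rw [tsum_congr h1, h2.tsum_eq_zero_add, ← lambertSum, coeff, if_pos rfl,
        if_neg hc0.ne', pow_zero, one_mul]
      ring
  obtain ⟨A, hA, hA'⟩ := hA
  have h1 := hasSum_pnat_of_hasSum_prod (f := fun a b =>
    residueTerm N c (z ^ d) p a b - residueTerm N (-c) (z ^ d)⁻¹ p a b) (hA.sub hB)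
  simp only [← coeff_mul_pow_eq_sum p (Nat.succ_ne_zero _)] at h1
  convert h1.zero_add (f := fun n : ℕ => coeff N z c d n * p ^ n) using 1
  rw [quasiZeta, pow_zero]
  linear_combination -hA'

/-! ### The Weil pairing of the basis, and the conclusion -/

lemma weilPairing_tau_div {N : ℕ} {k : ℤ} (hN : N ≠ 0) :
    weilPairing N τ ((τ : ℂ) / N) ((k : ℂ) / N) = expPeriod (k / N) := by
  have hτ := τ.im_pos.ne'
  have hN' : (N : ℝ) ≠ 0 := Nat.cast_ne_zero.mpr hN
  have h1 : ((τ : ℂ) / N * (starRingEnd ℂ) ((k : ℂ) / N)).im = τ.im * k / (N * N) := by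
    have : (τ : ℂ) / N * (starRingEnd ℂ) ((k : ℂ) / N) = ((k / (N * N) : ℝ) : ℂ) * τ := by
      rw [map_div₀, map_intCast, map_natCast]
      push_cast
      field_simp
    rw [this, im_ofReal_mul]
    simp
    ring
  rw [weilPairing, expPeriod, h1]
  congr 2
  have : (N : ℝ) * (τ.im * k / (N * N) / τ.im) = k / N := by field_simp
  rw [this]
  simp

end QExpansion

end Makdisi

end

theorem mainTheorem1 (N : ℕ) [NeZero N] :
    ∃ C : ℂ, C ≠ 0 ∧
      ∀ z : ℂ, IsPrimitiveRoot z N →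
      ∀ (c : ℕ) (d : ℤ), c < N →
      ∀ v : ZMod N × ZMod N, v = ((c : ZMod N), (d : ZMod N)) → v ≠ 0 →
      ∀ w : ZMod N × ZMod N, w ∉ AddSubgroup.zmultiples v →
      ∀ (τ : UpperHalfPlane) (k : ℤ), Makdisi.weilPairing N τ ((τ : ℂ) / N) ((k : ℂ) / N) = z →
      ∀ β : Makdisi.LevelStructure N (Makdisi.curve τ),
        Makdisi.Uniformizes τ ((τ : ℂ) / N) (β (1, 0) : (Makdisi.curve τ).toAffine.Point) →
        Makdisi.Uniformizes τ ((k : ℂ) / N) (β (0, 1) : (Makdisi.curve τ).toAffine.Point) →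
          HasSum (fun n : ℕ => C * (Makdisi.coeff N z c d n * Makdisi.qN N τ ^ n))
            (Makdisi.f₁ β v w) := by
  refine ⟨2 * Real.pi * Complex.I, Complex.two_pi_I_ne_zero, ?_⟩
  intro z _ c d hc v hv hv0 w hw τ k hz β h₁ h₂
  rw [Makdisi.f₁_eq_quasiZeta h₁ h₂ c d hv hv0 hw]
  exact (Makdisi.hasSum_coeff hc
    (hz.symm.trans (Makdisi.weilPairing_tau_div (NeZero.ne N)))).mul_left _
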